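/- Let $R$ be a commutative Noetherian ring, $M$ a finitely generated $R$-module and $q$ an integer. Write $(-)^* = \operatorname{Hom}_R(-,R)$. For a finite projective presentation $P_1 \xrightarrow{\sigma} P_0 \to M \to 0$, the Auslander transpose $\mathrm D(M)$ is the cokernel of $\sigma^* : P_0^* \to P_1^*$; it is unique up to projective equivalence. The module $M$ is called $q$-torsionfree if $\operatorname{Ext}^i_R(\mathrm D(M), R) = 0$ for all $i = 1, 2, \dots, q$ (no condition if $q \le 0$). The depth of a finitely generated module over a Noetherian local ring is the supremum of the lengths of regular sequences on it in the maximal ideal, with the convention that the zero module has depth $\infty$. The module $M$ satisfies $(\widetilde{\mathrm S}_q)$ if $\operatorname{depth}_{R_{\mathfrak p}} M_{\mathfrak p} \ge \min\{q, \operatorname{depth} R_{\mathfrak p}\}$ for every $\mathfrak p \in \operatorname{Spec} R$. Then the following conditions are equivalent: (1) $M$ is $q$-torsionfree; (2) $M_{\mathfrak p}$ is a $q$-torsionfree $R_{\mathfrak p}$-module for every $\mathfrak p \in \operatorname{Supp}_R M$ with $\operatorname{depth} R_{\mathfrak p} < q$, and $M$ satisfies $(\widetilde{\mathrm S}_q)$;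 (3) $M_{\mathfrak p}$ is a $q$-torsionfree $R_{\mathfrak p}$-module for every $\mathfrak p \in \operatorname{Supp}_R M$ with $\operatorname{depth}_{R_{\mathfrak p}} M_{\mathfrak p} < q$, and $\operatorname{depth}_{R_{\mathfrak p}} M_{\mathfrak p} = \operatorname{depth} R_{\mathfrak p}$ for every $\mathfrak p \in \operatorname{Supp}_R M$ with $\operatorname{depth} R_{\mathfrak p} < q - 1$. -/

import Mathlib

universe u v

namespace AuslanderBridger

/-- A finite projective presentation `P₁ --σ--> P₀ --π--> M --> 0` of an `R`-module `M`:
`P₁` and `P₀` are finitely generated projective and the sequence is exact. -/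
structure FiniteProjectivePresentation (R : Type u) [CommRing R]
    (M : Type v) [AddCommGroup M] [Module R M] where
  /-- the module of relations -/
  P₁ : Type u
  /-- the module of generators -/
  P₀ : Type u
  [addCommGroup₁ : AddCommGroup P₁]
  [module₁ : Module R P₁]
  [finite₁ : Module.Finite R P₁]
  [projective₁ : Module.Projective R P₁]
  [addCommGroup₀ : AddCommGroup P₀]
  [module₀ : Module R P₀]
  [finite₀ : Module.Finite R P₀]
  [projective₀ : Module.Projective R P₀]
  /-- the map `P₁ → P₀` -/
  σ : P₁ →ₗ[R] P₀
  /-- the map `P₀ → M` -/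
  π : P₀ →ₗ[R] M
  exact : Function.Exact σ π
  surjective : Function.Surjective π

attribute [instance] FiniteProjectivePresentation.addCommGroup₁
  FiniteProjectivePresentation.module₁ FiniteProjectivePresentation.finite₁
  FiniteProjectivePresentation.projective₁ FiniteProjectivePresentation.addCommGroup₀
  FiniteProjectivePresentation.module₀ FiniteProjectivePresentation.finite₀
  FiniteProjectivePresentation.projective₀

/-- The Auslander transpose `D_σ(M)`, the cokernel of `σ^* : P₀^* → P₁^*`, where
`(-)^* = Hom_R(-, R)`. -/
abbrev FiniteProjectivePresentation.transpose {R : Type u} [CommRing R]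
    {M : Type v} [AddCommGroup M] [Module R M]
    (P : FiniteProjectivePresentation R M) : Type u :=
  Module.Dual R P.P₁ ⧸ LinearMap.range P.σ.dualMap

/-- `M` is `q`-torsionfree if `Ext^i_R(D(M), R) = 0` for `i = 1, …, q`, where `D(M)` is the
Auslander transpose. As `D(M)` is determined by `M` up to projective direct summands, which
do not affect `Ext^i` for `i ≥ 1`, any one finite projective presentation of `M` may be used
to compute `D(M)`. The integer `q` is arbitrary; for `q ≤ 0` there is no condition on `Ext`. -/
def IsTorsionfreeOfOrder (q : ℤ) (R : Type u) [CommRing R]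
    (M : Type v) [AddCommGroup M] [Module R M] : Prop :=
  ∃ P : FiniteProjectivePresentation R M, ∀ i : ℕ, 1 ≤ i → (i : ℤ) ≤ q →
    Subsingleton (CategoryTheory.Abelian.Ext
      (ModuleCat.of R P.transpose) (ModuleCat.of R R) i)

/-- The depth of a module `M` over a local ring `(A, 𝔪)`: the supremum of the lengths of
`M`-regular sequences in `𝔪`, with `depth 0 = ∞`. For finitely generated `M ≠ 0` the condition
`(x₁, …, xₙ) M ≠ M` is automatic by Nakayama's lemma, so that weakly regular sequences in `𝔪`
are the same as regular ones; for `M = 0` every sequence is weakly regular. -/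
noncomputable def natDepth (A : Type u) [CommRing A] [IsLocalRing A]
    (M : Type v) [AddCommGroup M] [Module A M] : ℕ∞ :=
  ⨆ (rs : List A) (_ : ∀ r ∈ rs, r ∈ IsLocalRing.maximalIdeal A)
    (_ : RingTheory.Sequence.IsWeaklyRegular M rs), (rs.length : ℕ∞)

/-- The depth as an element of `ℤ ∪ {∞}`, so that it can be compared with any integer. -/
noncomputable def depth (A : Type u) [CommRing A] [IsLocalRing A]
    (M : Type v) [AddCommGroup M] [Module A M] : WithTop ℤ :=
  WithTop.map (fun n : ℕ => (n : ℤ)) (natDepth A M)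

/-- The local ring `R_𝔭`. -/
abbrev ringAt {R : Type u} [CommRing R] (p : PrimeSpectrum R) : Type u :=
  Localization.AtPrime p.asIdeal

/-- The `R_𝔭`-module `M_𝔭`. -/
abbrev moduleAt {R : Type u} [CommRing R] (M : Type v) [AddCommGroup M] [Module R M]
    (p : PrimeSpectrum R) : Type (max u v) :=
  LocalizedModule p.asIdeal.primeCompl M

/-- The condition `(S̃_n)`: `depth M_𝔭 ≥ min {n, depth R_𝔭}` for every prime `𝔭` of `R`. -/
def SatisfiesSTilde (n : ℤ) (R : Type u) [CommRing R]
    (M : Type v) [AddCommGroup M] [Module R M] : Prop :=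
  ∀ p : PrimeSpectrum R,
    min (n : WithTop ℤ) (depth (ringAt p) (ringAt p)) ≤ depth (ringAt p) (moduleAt M p)

end AuslanderBridger

/-! Embed torsionfreeness in an induction. Generators of `M^*` give `φ : M → Q` with `Q` finite free
and `φ^*` onto; let `C = coker φ`. Dualizing presentations gives `0 → D(C) → P₁^* → D(M) → 0`, so
`Ext^{i+1}(D(M), R)` and `Ext^i(D(C), R)` vanish together for `i ≥ 1`, while `Ext^1(D(M), R) = 0`
iff `φ` is injective. Hence `M` is `(n+1)`-torsionfree iff `φ` is injective and `C` is
`n`-torsionfree (`isTorsionfreeOfOrder_succ`).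

(1) ⇒ (2): torsionfreeness localizes, and the depth lemma along pushforwards gives the depth bound.
(2) ⇒ (3): the new point is `depth M_𝔭 ≤ depth R_𝔭` when `depth R_𝔭 < q - 1`
(`IsTorsionfreeOfOrder.not_succ_le_natDepth`), from two successive pushforwards and `Ext(k, -)`. (3)
⇒ (1): at each prime either `M_𝔭` is torsionfree or both depths are large. This forces `φ` to be
injective, by looking at an associated prime of `ker φ`, and it passes to `C`
(`isTorsionfreeOfOrder_of_forall`). -/

namespace AuslanderBridger

open CategoryTheory Abelian

/-! ### Pushforwards and the transpose -/

section Pushforward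

variable {R : Type u} [CommRing R]
  {M : Type u} [AddCommGroup M] [Module R M]
  {Q : Type u} [AddCommGroup Q] [Module R Q]
  {C : Type u} [AddCommGroup C] [Module R C]

/-- A sequence `M --φ--> Q --ψ--> C --> 0` that is exact and such that every functional on `M`
factors through `φ`. With `Q` finitely generated and projective, `φ` is a left approximation
of `M` by projectives. -/
structure IsPushforward (φ : M →ₗ[R] Q) (ψ : Q →ₗ[R] C) : Prop where
  dualMap_surjective : Function.Surjective φ.dualMap
  exact : Function.Exact φ ψ
  surjective : Function.Surjective ψ

theorem exists_isPushforward (R : Type u) [CommRing R] [IsNoetherianRing R]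
    (M : Type u) [AddCommGroup M] [Module R M] [Module.Finite R M] :
    ∃ (n : ℕ) (φ : M →ₗ[R] ULift.{u} (Fin n) → R),
      IsPushforward φ (LinearMap.range φ).mkQ := by
  obtain ⟨n, s, hs⟩ := Module.Finite.exists_fin (R := R) (M := Module.Dual R M)
  refine ⟨n, LinearMap.pi fun i => s i.down, ?_, LinearMap.exact_map_mkQ_range _,
    Submodule.mkQ_surjective _⟩
  rw [← LinearMap.range_eq_top, eq_top_iff, ← hs, Submodule.span_le]
  rintro _ ⟨i, rfl⟩
  exact ⟨LinearMap.proj ⟨i⟩, rfl⟩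

namespace FiniteProjectivePresentation

/-- The presentation of the cokernel of a pushforward whose relation module is `P₀`. -/
def pushforward [Module.Finite R Q] [Module.Projective R Q] (P : FiniteProjectivePresentation R M)
    {φ : M →ₗ[R] Q} {ψ : Q →ₗ[R] C} (h : IsPushforward φ ψ) :
    FiniteProjectivePresentation R C where
  P₁ := P.P₀
  P₀ := Q
  σ := φ ∘ₗ P.π
  π := ψ
  exact := fun y => (h.exact y).trans
    ⟨fun ⟨m, hm⟩ => by
      obtain ⟨x, rfl⟩ := P.surjective m
      exact ⟨x, hm⟩, fun ⟨x, hx⟩ => ⟨P.π x, hx⟩⟩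
  surjective := h.surjective

variable (P : FiniteProjectivePresentation R M)
    {φ : M →ₗ[R] Q} {ψ : Q →ₗ[R] C} (h : IsPushforward φ ψ)

include h in
-- By left exactness `π^*` identifies `M^*` with `ker σ^*`, and `φ^*` is onto `M^*`.
theorem range_dualMap_comp_π :
    LinearMap.range (φ ∘ₗ P.π).dualMap = LinearMap.ker P.σ.dualMap := by
  ext f
  constructor
  · rintro ⟨g, rfl⟩
    ext x
    simp [P.exact.apply_apply_eq_zero]
  · intro hf
    have hk : LinearMap.ker P.π ≤ LinearMap.ker f := by
      intro y hy
      obtain ⟨x, rfl⟩ := (P.exact y).1 hy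
      exact LinearMap.congr_fun hf x
    obtain ⟨g, hg⟩ := h.dualMap_surjective
      ((LinearMap.ker P.π).liftQ f hk ∘ₗ (P.π.quotKerEquivOfSurjective P.surjective).symm)
    refine ⟨g, ?_⟩
    ext x
    have := LinearMap.congr_fun hg (P.π x)
    simp only [LinearMap.dualMap_apply, LinearMap.comp_apply] at this ⊢
    rw [this]
    have e : (P.π.quotKerEquivOfSurjective P.surjective).symm (P.π x) =
        Submodule.Quotient.mk x := by
      rw [LinearEquiv.symm_apply_eq]; rfl
    simp [e]

variable [Module.Finite R Q] [Module.Projective R Q]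

/-- The embedding of the transpose of the pushforward into `P₁^*`. -/
def transposeι : (P.pushforward h).transpose →ₗ[R] Module.Dual R P.P₁ :=
  (LinearMap.range (φ ∘ₗ P.π).dualMap).liftQ P.σ.dualMap (P.range_dualMap_comp_π h).le

theorem transposeι_injective : Function.Injective (P.transposeι h) := by
  rw [← LinearMap.ker_eq_bot]
  exact Submodule.ker_liftQ_eq_bot _ _ _ (P.range_dualMap_comp_π h).ge

theorem transposeι_exact :
    Function.Exact (P.transposeι h) (LinearMap.range P.σ.dualMap).mkQ := by
  rw [LinearMap.exact_iff, Submodule.ker_mkQ]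
  exact (Submodule.range_liftQ _ _ _).symm

/-- The short exact sequence `0 → D(C) → P₁^* → D(M) → 0` for a pushforward `M → Q → C → 0`. -/
noncomputable abbrev transposeShortComplex : ShortComplex (ModuleCat.{u} R) :=
  ModuleCat.shortComplexOfCompEqZero (P.transposeι h) (LinearMap.range P.σ.dualMap).mkQ
    (P.transposeι_exact h).linearMap_comp_eq_zero

theorem transposeShortComplex_shortExact : (P.transposeShortComplex h).ShortExact :=
  ModuleCat.shortComplex_shortExact _ (P.transposeι_exact h) (P.transposeι_injective h)
    (Submodule.mkQ_surjective _)

instance : Projective (P.transposeShortComplex h).X₂ :=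
  inferInstanceAs (Projective (ModuleCat.of R (Module.Dual R P.P₁)))

theorem subsingleton_ext_transpose_succ {i : ℕ} (hi : 1 ≤ i) :
    Subsingleton (Ext (ModuleCat.of R P.transpose) (ModuleCat.of R R) (i + 1)) ↔
      Subsingleton (Ext (ModuleCat.of R (P.pushforward h).transpose) (ModuleCat.of R R) i) := by
  have hS := P.transposeShortComplex_shortExact h
  obtain ⟨j, rfl⟩ : ∃ j, i = j + 1 := ⟨i - 1, by omega⟩
  constructor
  · intro H
    refine subsingleton_of_forall_eq 0 fun x => ?_
    obtain ⟨y, rfl⟩ := Ext.contravariant_sequence_exact₁ hS _ x (add_comm 1 (j + 1))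
      (H.elim _ _)
    rw [Ext.eq_zero_of_projective y, Ext.comp_zero]
  · intro H
    refine subsingleton_of_forall_eq 0 fun x => ?_
    obtain ⟨y, rfl⟩ := Ext.contravariant_sequence_exact₃ hS _ x
      (Ext.eq_zero_of_projective _) (add_comm 1 (j + 1))
    rw [show y = 0 from H.elim _ _, Ext.comp_zero]

/-- As `P₁^*` is projective, `Ext^1(D(M), R)` is the cokernel of restriction from `P₁^*` to `D(C)`.
-/
theorem subsingleton_ext_transpose_one_iff_forall_exists :
    Subsingleton (Ext (ModuleCat.of R P.transpose) (ModuleCat.of R R) 1) ↔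
      ∀ f : (P.pushforward h).transpose →ₗ[R] R, ∃ g : Module.Dual R P.P₁ →ₗ[R] R,
        g ∘ₗ P.transposeι h = f := by
  have hS := P.transposeShortComplex_shortExact h
  constructor
  · intro H f
    obtain ⟨y, hy⟩ := Ext.contravariant_sequence_exact₁ hS _ (Ext.mk₀ (ModuleCat.ofHom f))
      (add_zero 1) (H.elim _ _)
    obtain ⟨g, rfl⟩ := Ext.mk₀_bijective _ _ |>.surjective y
    rw [Ext.mk₀_comp_mk₀] at hy
    have := (Ext.mk₀_bijective _ _).injective hy
    exact ⟨g.hom, congrArg ModuleCat.Hom.hom this⟩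
  · intro H
    refine subsingleton_of_forall_eq 0 fun x => ?_
    obtain ⟨y, rfl⟩ := Ext.contravariant_sequence_exact₃ hS _ x
      (Ext.eq_zero_of_projective _) (add_zero 1)
    obtain ⟨f, rfl⟩ := Ext.mk₀_bijective _ _ |>.surjective y
    obtain ⟨g, hg⟩ := H f.hom
    have : f = (P.transposeShortComplex h).f ≫ ModuleCat.ofHom g := by
      exact ModuleCat.hom_ext hg.symm
    rw [this, ← Ext.mk₀_comp_mk₀, hS.extClass_comp_assoc]

include h in
-- By biduality, functionals on `D(C) = P₀^* / im (φπ)^*` are the `x ∈ P₀` with `φ(π x) = 0`, and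
-- those extending to `P₁^*` are the `x ∈ im σ = ker π`. So the obstruction is exactly `ker φ`.
theorem subsingleton_ext_transpose_one :
    Subsingleton (Ext (ModuleCat.of R P.transpose) (ModuleCat.of R R) 1) ↔
      Function.Injective φ := by
  rw [P.subsingleton_ext_transpose_one_iff_forall_exists h]
  constructor
  · intro H
    rw [injective_iff_map_eq_zero]
    intro m hm
    obtain ⟨x, rfl⟩ := P.surjective m
    obtain ⟨g, hg⟩ := H ((LinearMap.range (φ ∘ₗ P.π).dualMap).liftQ
      (Module.Dual.eval R P.P₀ x) (by
        rintro _ ⟨f, rfl⟩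
        simp [hm]))
    obtain ⟨z, rfl⟩ := (Module.evalEquiv R P.P₁).surjective g
    have : P.σ z = x := by
      apply (Module.evalEquiv R P.P₀).injective
      ext f
      exact LinearMap.congr_fun hg (Submodule.Quotient.mk f)
    rw [← this, P.exact.apply_apply_eq_zero]
  · intro hφ f
    obtain ⟨x, hx⟩ := (Module.evalEquiv R P.P₀).surjective
      (f ∘ₗ (LinearMap.range (φ ∘ₗ P.π).dualMap).mkQ)
    have hx' : ∀ g : Module.Dual R P.P₀, g x = f (Submodule.Quotient.mk g) :=
      fun g => LinearMap.congr_fun hx g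
    have hφx : φ (P.π x) = 0 := by
      rw [← Module.forall_dual_apply_eq_zero_iff R]
      intro g
      have hz : (LinearMap.range (φ ∘ₗ P.π).dualMap).mkQ ((φ ∘ₗ P.π).dualMap g) = 0 :=
        (Submodule.Quotient.mk_eq_zero _).2 (LinearMap.mem_range.2 ⟨g, rfl⟩)
      exact (hx' ((φ ∘ₗ P.π).dualMap g)).trans ((congrArg f hz).trans (map_zero f))
    obtain ⟨z, rfl⟩ := (P.exact x).1 (hφ (hφx.trans (map_zero φ).symm))
    refine ⟨Module.Dual.eval R P.P₁ z, ?_⟩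
    refine Submodule.linearMap_qext _ (LinearMap.ext fun g => ?_)
    exact hx' g

end FiniteProjectivePresentation

end Pushforward

/-! ### Independence of the presentation and the inductive criterion -/

section Presentation

variable {R : Type u} [CommRing R]

/-- The transport of a presentation along an isomorphism. -/
def FiniteProjectivePresentation.congr {M : Type*} [AddCommGroup M] [Module R M]
    {N : Type*} [AddCommGroup N] [Module R N] (P : FiniteProjectivePresentation R M)
    (e : M ≃ₗ[R] N) : FiniteProjectivePresentation R N where
  P₁ := P.P₁
  P₀ := P.P₀
  σ := P.σ
  π := e.toLinearMap ∘ₗ P.π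
  exact := fun y => by simpa using P.exact y
  surjective := e.surjective.comp P.surjective

theorem isTorsionfreeOfOrder_congr {M : Type*} [AddCommGroup M] [Module R M]
    {N : Type*} [AddCommGroup N] [Module R N] (e : M ≃ₗ[R] N) (q : ℤ) :
    IsTorsionfreeOfOrder q R M ↔ IsTorsionfreeOfOrder q R N :=
  ⟨fun ⟨P, hP⟩ => ⟨P.congr e, hP⟩, fun ⟨P, hP⟩ => ⟨P.congr e.symm, hP⟩⟩

theorem isTorsionfreeOfOrder_toNat (q : ℤ) (M : Type*) [AddCommGroup M] [Module R M] :
    IsTorsionfreeOfOrder q R M ↔ IsTorsionfreeOfOrder q.toNat R M :=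
  exists_congr fun _ => forall_congr' fun i => forall_congr' fun _ => by
    rw [show ((i : ℤ) ≤ q ↔ (i : ℤ) ≤ q.toNat) by omega]

variable [IsNoetherianRing R]

theorem nonempty_finiteProjectivePresentation (M : Type v) [AddCommGroup M] [Module R M]
    [Module.Finite R M] : Nonempty (FiniteProjectivePresentation R M) := by
  obtain ⟨n, f, hf⟩ := Module.Finite.exists_fin' R M
  obtain ⟨m, g, hg⟩ := Module.Finite.exists_fin' R (LinearMap.ker f)
  refine ⟨{ P₁ := Fin m → R, P₀ := Fin n → R, σ := (LinearMap.ker f).subtype ∘ₗ g, π := f,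
            exact := ?_, surjective := hf }⟩
  rw [LinearMap.exact_iff, LinearMap.range_comp, LinearMap.range_eq_top.2 hg]
  simp

variable {M : Type u} [AddCommGroup M] [Module R M] [Module.Finite R M]

/-- In degree 1 the criterion `Function.Injective φ` does not see the presentation; in higher
degrees both presentations push forward to presentations of the same cokernel. -/
theorem FiniteProjectivePresentation.subsingleton_ext_transpose_iff {i : ℕ} (hi : 1 ≤ i)
    (P P' : FiniteProjectivePresentation R M) :
    Subsingleton (Ext (ModuleCat.of R P.transpose) (ModuleCat.of R R) i) ↔
      Subsingleton (Ext (ModuleCat.of R P'.transpose) (ModuleCat.of R R) i) := by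
  induction i, hi using Nat.le_induction generalizing M with
  | base =>
    obtain ⟨n, φ, h⟩ := exists_isPushforward R M
    rw [P.subsingleton_ext_transpose_one h, P'.subsingleton_ext_transpose_one h]
  | succ i hi ih =>
    obtain ⟨n, φ, h⟩ := exists_isPushforward R M
    rw [P.subsingleton_ext_transpose_succ h hi, P'.subsingleton_ext_transpose_succ h hi]
    exact ih _ _

theorem isTorsionfreeOfOrder_iff (P : FiniteProjectivePresentation R M) (q : ℤ) :
    IsTorsionfreeOfOrder q R M ↔ ∀ i : ℕ, 1 ≤ i → (i : ℤ) ≤ q →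
      Subsingleton (Ext (ModuleCat.of R P.transpose) (ModuleCat.of R R) i) :=
  ⟨fun ⟨P', hP'⟩ i hi hiq => (P.subsingleton_ext_transpose_iff hi P').2 (hP' i hi hiq),
    fun H => ⟨P, H⟩⟩

theorem isTorsionfreeOfOrder_zero (M : Type v) [AddCommGroup M] [Module R M] [Module.Finite R M] :
    IsTorsionfreeOfOrder (0 : ℕ) R M :=
  (nonempty_finiteProjectivePresentation M).elim fun P => ⟨P, fun i hi hi' => by omega⟩

theorem isTorsionfreeOfOrder_succ {Q : Type u} [AddCommGroup Q] [Module R Q] [Module.Finite R Q]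
    [Module.Projective R Q] {C : Type u} [AddCommGroup C] [Module R C]
    {φ : M →ₗ[R] Q} {ψ : Q →ₗ[R] C} (h : IsPushforward φ ψ) (n : ℕ) :
    IsTorsionfreeOfOrder (n + 1 : ℕ) R M ↔
      Function.Injective φ ∧ IsTorsionfreeOfOrder n R C := by
  have : Module.Finite R C := Module.Finite.of_surjective ψ h.surjective
  obtain ⟨P⟩ := nonempty_finiteProjectivePresentation (R := R) M
  rw [isTorsionfreeOfOrder_iff P, isTorsionfreeOfOrder_iff (P.pushforward h),
    ← P.subsingleton_ext_transpose_one h]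
  constructor
  · exact fun H => ⟨H 1 le_rfl (by omega), fun i hi hin =>
      (P.subsingleton_ext_transpose_succ h hi).1 (H (i + 1) (by omega) (by omega))⟩
  · rintro ⟨H1, H⟩ i hi hin
    rcases hi.eq_or_lt with rfl | hi
    · exact H1
    · obtain ⟨j, rfl⟩ : ∃ j, i = j + 1 := ⟨i - 1, by omega⟩
      exact (P.subsingleton_ext_transpose_succ h (by omega)).2 (H j (by omega) (by omega))

end Presentation

end AuslanderBridger

namespace AuslanderBridger

/-! ### Localization of torsionfreeness -/

section Localization

variable {R : Type u} [CommRing R] [IsNoetherianRing R]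
  {M : Type u} [AddCommGroup M] [Module R M] [Module.Finite R M]
  {Q : Type u} [AddCommGroup Q] [Module R Q]
  {C : Type u} [AddCommGroup C] [Module R C]

theorem IsPushforward.localization {φ : M →ₗ[R] Q} {ψ : Q →ₗ[R] C} (h : IsPushforward φ ψ)
    (S : Submonoid R) :
    IsPushforward (LocalizedModule.map S φ) (LocalizedModule.map S ψ) where
  exact := LocalizedModule.map_exact S φ ψ h.exact
  surjective := IsLocalizedModule.map_surjective S (LocalizedModule.mkLinearMap S Q)
    (LocalizedModule.mkLinearMap S C) ψ h.surjective
  dualMap_surjective := by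
    intro g
    have := Module.finitePresentation_of_finite R M
    let E := fun (N : Type u) [AddCommGroup N] [Module R N] =>
      IsLocalizedModule.mapExtendScalars S (LocalizedModule.mkLinearMap S N)
        (Algebra.linearMap R (Localization S)) (Localization S)
    -- Since `M` is finitely presented, a functional on the localization is `1/s` times a localized
    -- functional `f`, and `f` factors through `φ`.
    obtain ⟨⟨f, s⟩, hf⟩ := IsLocalizedModule.surj S (E M) g
    obtain ⟨f', rfl⟩ := h.dualMap_surjective f
    refine ⟨(IsLocalization.mk' (Localization S) 1 s) • E Q f', ?_⟩
    have key : (LocalizedModule.map S φ).dualMap (E Q f') = E M (φ.dualMap f') := by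
      apply LinearMap.restrictScalars_injective R
      apply IsLocalizedModule.ext S (LocalizedModule.mkLinearMap S M)
        (IsLocalizedModule.map_units (Algebra.linearMap R (Localization S)))
      ext m
      simp [E, LocalizedModule.map, IsLocalizedModule.map_apply, -LocalizedModule.mkLinearMap_apply]
    rw [map_smul, key, ← hf, Submonoid.smul_def, ← algebraMap_smul (Localization S) (s : R) g,
      smul_smul, IsLocalization.mk'_spec, map_one, one_smul]

theorem IsTorsionfreeOfOrder.localization {n : ℕ} (hM : IsTorsionfreeOfOrder n R M)
    (S : Submonoid R) : IsTorsionfreeOfOrder n (Localization S) (LocalizedModule S M) := by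
  have : IsNoetherianRing (Localization S) := IsLocalization.isNoetherianRing S _ ‹_›
  have hfin (N : Type u) [AddCommGroup N] [Module R N] [Module.Finite R N] :
      Module.Finite (Localization S) (LocalizedModule S N) :=
    Module.Finite.of_isLocalizedModule S (LocalizedModule.mkLinearMap S N)
  induction n generalizing M with
  | zero => exact isTorsionfreeOfOrder_zero _
  | succ n ih =>
    obtain ⟨k, φ, h⟩ := exists_isPushforward R M
    rw [isTorsionfreeOfOrder_succ h] at hM
    rw [isTorsionfreeOfOrder_succ (h.localization S)]
    exact ⟨IsLocalizedModule.map_injective S (LocalizedModule.mkLinearMap S _)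
      (LocalizedModule.mkLinearMap S _) φ hM.1, ih hM.2⟩

end Localization

end AuslanderBridger

namespace AuslanderBridger

open CategoryTheory Abelian RingTheory.Sequence IsLocalRing

/-! ### Depth and `Ext` from the residue field -/

section NatDepth

variable {A : Type u} [CommRing A] [IsLocalRing A]

theorem le_natDepth_iff_exists (M : Type v) [AddCommGroup M] [Module A M] (n : ℕ) :
    (n : ℕ∞) ≤ natDepth A M ↔ ∃ rs : List A, rs.length = n ∧
      (∀ r ∈ rs, r ∈ maximalIdeal A) ∧ IsWeaklyRegular M rs := by
  constructor
  · intro h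
    cases n with
    | zero => exact ⟨[], rfl, by simp, IsWeaklyRegular.nil A M⟩
    | succ n =>
      have hlt : (n : ℕ∞) < natDepth A M :=
        lt_of_lt_of_le (Nat.cast_lt.2 n.lt_succ_self) h
      simp only [natDepth, lt_iSup_iff, Nat.cast_lt] at hlt
      obtain ⟨rs, hm, hr, hn⟩ := hlt
      refine ⟨rs.take (n + 1), by simpa using hn, fun r hr' => hm r (List.mem_of_mem_take hr'), ?_⟩
      rw [← List.take_append_drop (n + 1) rs, isWeaklyRegular_append_iff] at hr
      exact hr.1
  · rintro ⟨rs, rfl, hm, hr⟩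
    exact le_iSup_of_le rs (le_iSup_of_le hm (le_iSup_of_le hr le_rfl))

theorem natDepth_congr {M : Type*} [AddCommGroup M] [Module A M]
    {N : Type*} [AddCommGroup N] [Module A N] (e : M ≃ₗ[A] N) :
    natDepth A M = natDepth A N := by
  simp only [natDepth, e.isWeaklyRegular_congr]

/-- Tensoring with a flat module preserves weak regularity; no faithfulness is needed, so `Q = 0` is
allowed. -/
theorem natDepth_self_le_of_flat (Q : Type v) [AddCommGroup Q] [Module A Q] [Module.Flat A Q] :
    natDepth A A ≤ natDepth A Q :=
  iSup_mono fun rs => iSup_mono fun _ => iSup_mono' fun h =>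
    ⟨((TensorProduct.rid A Q).isWeaklyRegular_congr rs).1 h.isWeaklyRegular_lTensor, le_rfl⟩

theorem exists_isSMulRegular_of_one_le_natDepth {M : Type v} [AddCommGroup M] [Module A M]
    (h : ((1 : ℕ) : ℕ∞) ≤ natDepth A M) : ∃ r ∈ maximalIdeal A, IsSMulRegular M r := by
  obtain ⟨rs, hl, hm, hr⟩ := (le_natDepth_iff_exists M 1).1 h
  obtain ⟨r, rfl⟩ := List.length_eq_one_iff.1 hl
  exact ⟨r, hm r (by simp), (isWeaklyRegular_singleton_iff M r).1 hr⟩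

omit [IsLocalRing A] in
theorem isWeaklyRegular_of_subsingleton (M : Type v) [AddCommGroup M] [Module A M]
    [Subsingleton M] (rs : List A) : IsWeaklyRegular M rs :=
  (isWeaklyRegular_iff M rs).2 fun _ _ =>
    fun _ _ _ => (Submodule.mkQ_surjective _).subsingleton.elim _ _

variable [IsNoetherianRing A]

/-- Rees's characterization of depth. The zero module is separate because the regular-sequence
theorems require `𝔪 M ≠ M`. -/
theorem le_natDepth_iff_subsingleton_ext (M : Type u) [AddCommGroup M] [Module A M]
    [Module.Finite A M] (n : ℕ) :
    (n : ℕ∞) ≤ natDepth A M ↔ ∀ i < n,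
      Subsingleton (Ext (ModuleCat.of A (ResidueField A)) (ModuleCat.of A M) i) := by
  have hsupp : Module.support A (ResidueField A) = PrimeSpectrum.zeroLocus (maximalIdeal A) := by
    rw [Module.support_eq_zeroLocus]
    exact congrArg (fun I : Ideal A => PrimeSpectrum.zeroLocus (I : Set A))
      Ideal.annihilator_quotient
  rw [le_natDepth_iff_exists]
  cases subsingleton_or_nontrivial M with
  | inl hM =>
    refine ⟨fun _ i _ => ?_, fun _ => ⟨List.replicate n 0, by simp, fun r hr => ?_,
      isWeaklyRegular_of_subsingleton M _⟩⟩
    · have hz : Limits.IsZero (ModuleCat.of A M) := ModuleCat.isZero_of_subsingleton _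
      refine subsingleton_of_forall_eq 0 fun x => ?_
      rw [← Ext.comp_mk₀_id x, hz.eq_of_src (𝟙 _) 0, Ext.mk₀_zero, Ext.comp_zero]
    · rw [(List.mem_replicate.1 hr).2]
      exact zero_mem _
  | inr hM =>
    have hlt : maximalIdeal A • (⊤ : Submodule A M) < ⊤ :=
      (Submodule.top_ne_ideal_smul_of_le_jacobson_annihilator
        (maximalIdeal_le_jacobson _)).symm.lt_top
    constructor
    · rintro ⟨rs, rfl, hm, hr⟩
      exact ModuleCat.subsingleton_ext_of_exists_isRegular (maximalIdeal A)
        (ModuleCat.of A (ResidueField A)) hsupp.le (ModuleCat.of A M) hlt rs hm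
        (IsRegular.of_isWeaklyRegular_of_mem_maximalIdeal M hm hr)
    · intro h
      obtain ⟨rs, hl, hm, hr⟩ := ModuleCat.exists_isRegular_of_exists_subsingleton_ext
        (maximalIdeal A) n (ModuleCat.of A M) hlt (ModuleCat.of A (ResidueField A)) hsupp h
      exact ⟨rs, hl, hm, hr.toIsWeaklyRegular⟩

variable {M : Type u} [AddCommGroup M] [Module A M]
  {Q : Type u} [AddCommGroup Q] [Module A Q]
  {C : Type u} [AddCommGroup C] [Module A C]
  {φ : M →ₗ[A] Q} {ψ : Q →ₗ[A] C}

/-- A short exact sequence of modules, as a short complex. -/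
abbrev shortComplexOfExact (hex : Function.Exact φ ψ) : ShortComplex (ModuleCat.{u} A) :=
  ModuleCat.shortComplexOfCompEqZero φ ψ hex.linearMap_comp_eq_zero

omit [IsLocalRing A] [IsNoetherianRing A] in
theorem shortComplexOfExact_shortExact (hex : Function.Exact φ ψ)
    (hφ : Function.Injective φ) (hψ : Function.Surjective ψ) :
    (shortComplexOfExact hex).ShortExact :=
  ModuleCat.shortComplex_shortExact _ hex hφ hψ

omit [IsNoetherianRing A] in
/-- A map `A → Q` with image in `𝔪 Q` induces the zero map on `Ext^t(k, -)`. -/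
theorem ext_comp_toSpanSingleton_eq_zero {w : Q}
    (hw : w ∈ maximalIdeal A • (⊤ : Submodule A Q)) {t : ℕ}
    (x : Ext (ModuleCat.of A (ResidueField A)) (ModuleCat.of A A) t) :
    x.comp (Ext.mk₀ (ModuleCat.ofHom (LinearMap.toSpanSingleton A Q w))) (add_zero t) = 0 := by
  induction hw using Submodule.smul_induction_on' with
  | smul a ha y _ =>
    -- `a ∈ 𝔪` kills `k`, hence kills `Ext(k, -)`.
    have h0 : a • x = 0 := by
      have h : a • 𝟙 (ModuleCat.of A (ResidueField A)) = 0 := by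
        ext z
        change a • z = 0
        rw [Algebra.smul_def, show algebraMap A (ResidueField A) a = 0 from
          (residue_eq_zero_iff a).2 ha, zero_mul]
      rw [← Ext.mk₀_id_comp x, ← Ext.smul_comp, ← Ext.mk₀_smul, h, Ext.mk₀_zero, Ext.zero_comp]
    have : ModuleCat.ofHom (LinearMap.toSpanSingleton A Q (a • y)) =
        a • ModuleCat.ofHom (LinearMap.toSpanSingleton A Q y) := by
      ext; simp
    rw [this, Ext.mk₀_smul, Ext.comp_smul, ← Ext.smul_comp, h0, Ext.zero_comp]
  | add y _ z _ hy hz =>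
    have : ModuleCat.ofHom (LinearMap.toSpanSingleton A Q (y + z)) =
        ModuleCat.ofHom (LinearMap.toSpanSingleton A Q y) +
          ModuleCat.ofHom (LinearMap.toSpanSingleton A Q z) := by
      ext; simp
    rw [this, Ext.mk₀_add, Ext.comp_add, hy, hz, add_zero]

variable [Module.Finite A M] [Module.Finite A Q] [Module.Finite A C]

theorem le_natDepth_right (hex : Function.Exact φ ψ)
    (hφ : Function.Injective φ) (hψ : Function.Surjective ψ) {n : ℕ}
    (hM : ((n + 1 : ℕ) : ℕ∞) ≤ natDepth A M) (hQ : (n : ℕ∞) ≤ natDepth A Q) :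
    (n : ℕ∞) ≤ natDepth A C := by
  rw [le_natDepth_iff_subsingleton_ext] at hM hQ ⊢
  intro i hi
  refine subsingleton_of_forall_eq 0 fun x => ?_
  obtain ⟨y, rfl⟩ := Ext.covariant_sequence_exact₃ _ (shortComplexOfExact_shortExact hex hφ hψ) x
    rfl ((hM (i + 1) (by omega)).elim _ _)
  rw [show y = 0 from (hQ i hi).elim _ _, Ext.zero_comp]

theorem le_natDepth_left (hex : Function.Exact φ ψ)
    (hφ : Function.Injective φ) (hψ : Function.Surjective ψ) {n : ℕ}
    (hQ : ((n + 1 : ℕ) : ℕ∞) ≤ natDepth A Q) (hC : (n : ℕ∞) ≤ natDepth A C) :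
    ((n + 1 : ℕ) : ℕ∞) ≤ natDepth A M := by
  rw [le_natDepth_iff_subsingleton_ext] at hC hQ ⊢
  intro i hi
  have hS := shortComplexOfExact_shortExact hex hφ hψ
  refine subsingleton_of_forall_eq 0 fun x => ?_
  cases i with
  | zero =>
    apply Ext.postcomp_mk₀_injective_of_mono _ (shortComplexOfExact hex).f (hf := hS.mono_f)
    exact (hQ 0 hi).elim _ _
  | succ i =>
    obtain ⟨y, rfl⟩ := Ext.covariant_sequence_exact₁ _ hS x ((hQ (i + 1) hi).elim _ _) rfl
    rw [show y = 0 from (hC i (by omega)).elim _ _, Ext.zero_comp]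

omit [Module.Finite A M] [Module.Finite A Q] in
/-- The map `Ext^t(k, M) → Ext^t(k, Q)` is injective if `Ext^i(k, C) = 0` for `i < t`. -/
theorem ext_postcomp_injective (hex : Function.Exact φ ψ)
    (hφ : Function.Injective φ) (hψ : Function.Surjective ψ) {t : ℕ}
    (hC : (t : ℕ∞) ≤ natDepth A C)
    (x : Ext (ModuleCat.of A (ResidueField A)) (ModuleCat.of A M) t)
    (hx : x.comp (Ext.mk₀ (ModuleCat.ofHom φ)) (add_zero t) = 0) : x = 0 := by
  have hS := shortComplexOfExact_shortExact hex hφ hψ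
  rw [le_natDepth_iff_subsingleton_ext] at hC
  cases t with
  | zero =>
    apply Ext.postcomp_mk₀_injective_of_mono _ (shortComplexOfExact hex).f (hf := hS.mono_f)
    rw [map_zero]
    exact hx
  | succ t =>
    obtain ⟨y, rfl⟩ := Ext.covariant_sequence_exact₁ _ hS x hx rfl
    rw [show y = 0 from (hC t (by omega)).elim _ _, Ext.zero_comp]

omit [Module.Finite A Q] [Module.Finite A C] in
/-- The map `Ext^t(k, Q) → Ext^t(k, C)` is injective if `Ext^t(k, M) = 0`. -/
theorem ext_postcomp_injective_right (hex : Function.Exact φ ψ)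
    (hφ : Function.Injective φ) (hψ : Function.Surjective ψ) {t : ℕ}
    (hM : ((t + 1 : ℕ) : ℕ∞) ≤ natDepth A M)
    (x : Ext (ModuleCat.of A (ResidueField A)) (ModuleCat.of A Q) t)
    (hx : x.comp (Ext.mk₀ (ModuleCat.ofHom ψ)) (add_zero t) = 0) : x = 0 := by
  have hS := shortComplexOfExact_shortExact hex hφ hψ
  rw [le_natDepth_iff_subsingleton_ext] at hM
  obtain ⟨y, rfl⟩ := Ext.covariant_sequence_exact₂ _ hS x hx
  rw [show y = 0 from (hM t (by omega)).elim _ _, Ext.zero_comp]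

end NatDepth

end AuslanderBridger

namespace AuslanderBridger

open CategoryTheory Abelian IsLocalRing

theorem IsTorsionfreeOfOrder.mono {R : Type u} [CommRing R] {M : Type v} [AddCommGroup M]
    [Module R M] {m n : ℤ} (h : IsTorsionfreeOfOrder n R M) (hmn : m ≤ n) :
    IsTorsionfreeOfOrder m R M :=
  h.imp fun _ hP i hi him => hP i hi (him.trans hmn)

theorem isTorsionfreeOfOrder_of_subsingleton {R : Type u} [CommRing R] (M : Type v)
    [AddCommGroup M] [Module R M] [Subsingleton M] (q : ℤ) : IsTorsionfreeOfOrder q R M := by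
  let P : FiniteProjectivePresentation R M :=
    { P₁ := PUnit, P₀ := PUnit, σ := 0, π := 0
      exact := fun y => iff_of_true rfl ⟨0, rfl⟩
      surjective := fun y => ⟨0, Subsingleton.elim _ _⟩ }
  refine ⟨P, fun i _ _ => subsingleton_of_forall_eq 0 fun x => ?_⟩
  have : Subsingleton P.transpose :=
    have : Subsingleton (Module.Dual R P.P₁) := inferInstanceAs (Subsingleton (PUnit.{u + 1} →ₗ[R] R))
    (Submodule.mkQ_surjective _).subsingleton
  have hz : Limits.IsZero (ModuleCat.of R P.transpose) := ModuleCat.isZero_of_subsingleton _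
  rw [← Ext.mk₀_id_comp x, hz.eq_of_src (𝟙 _) 0, Ext.mk₀_zero, Ext.zero_comp]

/-! ### Depth of torsionfree modules over a local ring -/

section Local

variable {A : Type u} [CommRing A] [IsLocalRing A] [IsNoetherianRing A]
  {M : Type u} [AddCommGroup M] [Module A M] [Module.Finite A M]

theorem IsTorsionfreeOfOrder.le_natDepth {n k : ℕ} (hM : IsTorsionfreeOfOrder n A M)
    (hkn : k ≤ n) (hk : (k : ℕ∞) ≤ natDepth A A) : (k : ℕ∞) ≤ natDepth A M := by
  induction n generalizing M k with
  | zero =>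
    obtain rfl : k = 0 := by omega
    simp
  | succ n ih =>
    cases k with
    | zero => simp
    | succ k =>
      obtain ⟨m, φ, h⟩ := exists_isPushforward A M
      rw [isTorsionfreeOfOrder_succ h] at hM
      exact le_natDepth_left h.exact hM.1 h.surjective (hk.trans (natDepth_self_le_of_flat _))
        (ih hM.2 (by omega) ((Nat.cast_le.2 k.le_succ).trans hk))

omit [IsNoetherianRing A] in
/-- A map of finite free modules over a local ring is injective if it carries no unimodular
vector into `𝔪 Q'`. -/
theorem injective_of_forall_notMem_smul_top {Q Q' : Type u} [AddCommGroup Q] [Module A Q]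
    [Module.Finite A Q] [AddCommGroup Q'] [Module A Q'] [Module.Finite A Q']
    [Module.Free A Q'] (f : Q →ₗ[A] Q')
    (h : ∀ v, f v ∈ maximalIdeal A • (⊤ : Submodule A Q') →
      v ∈ maximalIdeal A • (⊤ : Submodule A Q)) :
    Function.Injective f := by
  have hmk (N : Type u) [AddCommGroup N] [Module A N] (v : N) :
      TensorProduct.mk A (ResidueField A) N 1 v = 0 ↔
        v ∈ maximalIdeal A • (⊤ : Submodule A N) := by
    rw [← LinearMap.mem_ker]
    exact SetLike.ext_iff.1 (LinearMap.ker_tensorProductMk (Q := N) (I := maximalIdeal A)) v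
  obtain ⟨l, hl⟩ := (IsLocalRing.split_injective_iff_lTensor_residueField_injective f).2 (by
    rw [injective_iff_map_eq_zero]
    intro x hx
    obtain ⟨v, rfl⟩ := TensorProduct.mk_surjective A Q (ResidueField A)
      (Ideal.Quotient.mk_surjective) x
    exact (hmk Q v).2 (h v ((hmk Q' (f v)).1 hx)))
  exact Function.LeftInverse.injective (g := l) (LinearMap.congr_fun hl)

omit [IsNoetherianRing A] in
/-- Over a local ring, a vector of a finite free module outside `𝔪 Q` is unimodular. -/
theorem exists_dual_apply_eq_one {Q : Type u} [AddCommGroup Q] [Module A Q]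
    [Module.Finite A Q] [Module.Free A Q] {v : Q}
    (hv : v ∉ maximalIdeal A • (⊤ : Submodule A Q)) : ∃ f : Q →ₗ[A] A, f v = 1 := by
  let b := Module.Free.chooseBasis A Q
  have : ∃ i, IsUnit (b.repr v i) := by
    by_contra! H
    apply hv
    rw [← b.sum_repr v]
    exact Submodule.sum_mem _ fun i _ =>
      Submodule.smul_mem_smul ((mem_maximalIdeal _).2 (H i)) trivial
  obtain ⟨i, u, hu⟩ := this
  refine ⟨(↑u⁻¹ : A) • b.coord i, ?_⟩
  simp [← hu]

/-- Take `0 → M → Q → C → 0` and `0 → C → Q' → C' → 0`. If `depth M > t`, then `Ext^t(k, Q) →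
Ext^t(k, C)` is injective, and so is `Ext^t(k, C) → Ext^t(k, Q')` because `C'` is `t`-torsionfree
and so has depth at least `t`. As `Ext^t(k, A) ≠ 0`, the composite `Q → Q'` can send no unimodular
vector into `𝔪 Q'`. Hence it is injective; but it kills the image of `M`, so `M = 0`. -/
theorem IsTorsionfreeOfOrder.not_succ_le_natDepth [Nontrivial M] {t : ℕ}
    (hM : IsTorsionfreeOfOrder (t + 2 : ℕ) A M) (ht : (t : ℕ∞) ≤ natDepth A A)
    (ht' : ¬ ((t + 1 : ℕ) : ℕ∞) ≤ natDepth A A) : ¬ ((t + 1 : ℕ) : ℕ∞) ≤ natDepth A M := by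
  intro hdM
  obtain ⟨m, φ, h⟩ := exists_isPushforward A M
  obtain ⟨hφ, hC⟩ := (isTorsionfreeOfOrder_succ h (t + 1)).1 hM
  obtain ⟨m', φ', h'⟩ := exists_isPushforward A
    ((ULift.{u} (Fin m) → A) ⧸ LinearMap.range φ)
  obtain ⟨hφ', hC'⟩ := (isTorsionfreeOfOrder_succ h' t).1 hC
  have hdC' := hC'.le_natDepth le_rfl ht
  have hinj : Function.Injective (φ' ∘ₗ (LinearMap.range φ).mkQ) := by
    refine injective_of_forall_notMem_smul_top _ fun v hv => ?_
    by_contra hv'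
    obtain ⟨f, hf⟩ := exists_dual_apply_eq_one hv'
    -- A unimodular `v` with image in `𝔪 Q'` would force `Ext^t(k, A) = 0`, hence `depth A > t`.
    refine ht' ((le_natDepth_iff_subsingleton_ext A (t + 1)).2 fun i hi => ?_)
    rcases (Nat.lt_succ_iff.1 hi).lt_or_eq with hi | rfl
    · exact (le_natDepth_iff_subsingleton_ext A t).1 ht i hi
    refine subsingleton_of_forall_eq 0 fun x => ?_
    have hx : x.comp (Ext.mk₀ (ModuleCat.ofHom (LinearMap.toSpanSingleton A _ v)))
        (add_zero i) = 0 := by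
      apply ext_postcomp_injective_right h.exact hφ h.surjective hdM
      apply ext_postcomp_injective h'.exact hφ' h'.surjective hdC'
      rw [Ext.comp_assoc_of_second_deg_zero, Ext.mk₀_comp_mk₀,
        Ext.comp_assoc_of_second_deg_zero, Ext.mk₀_comp_mk₀,
        ← ext_comp_toSpanSingleton_eq_zero hv x]
      congr 2
      ext
      simp
    have hfv : ModuleCat.ofHom (LinearMap.toSpanSingleton A _ v) ≫ ModuleCat.ofHom f =
        𝟙 (ModuleCat.of A A) := by
      ext
      simp [hf]
    -- `f` retracts `v : A → Q`, so `x` vanishes once its image in `Ext^t(k, Q)` does.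
    rw [← Ext.comp_mk₀_id x, ← hfv, ← Ext.mk₀_comp_mk₀, ← Ext.comp_assoc_of_second_deg_zero,
      hx, Ext.zero_comp]
  obtain ⟨y, hy⟩ := exists_ne (0 : M)
  refine hy (hφ (hinj ?_))
  rw [map_zero, map_zero, LinearMap.comp_apply, h.exact.apply_apply_eq_zero, map_zero]

theorem IsTorsionfreeOfOrder.natDepth_eq [Nontrivial M] {n : ℕ}
    (hM : IsTorsionfreeOfOrder n A M) (hn : natDepth A A < ((n - 1 : ℕ) : ℕ∞)) :
    natDepth A M = natDepth A A := by
  obtain ⟨t, ht⟩ := ENat.ne_top_iff_exists.1 hn.ne_top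
  rw [← ht, Nat.cast_lt] at hn
  refine le_antisymm ?_ ?_
  · rw [← ht]
    by_contra! H
    -- `t < n - 1`, even with truncated subtraction, gives `t + 2 ≤ n`.
    refine (hM.mono (m := (t + 2 : ℕ)) (by omega)).not_succ_le_natDepth ht.le ?_
      (by exact_mod_cast Order.add_one_le_of_lt H)
    rw [← ht, Nat.cast_le]
    omega
  · rw [← ht]
    exact hM.le_natDepth (by omega) ht.le

end Local

/-! ### From local to global -/

section Global

variable {R : Type u} [CommRing R] [IsNoetherianRing R]
  {M : Type u} [AddCommGroup M] [Module R M] [Module.Finite R M]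

omit [IsNoetherianRing R] [Module.Finite R M] in
/-- If the prime `𝔭` is the annihilator of an element of `M`, then `depth M_𝔭 = 0`. -/
theorem not_one_le_natDepth_of_forall_mem_iff {p : PrimeSpectrum R} {x : M}
    (hx : ∀ r, r ∈ p.asIdeal ↔ r • x = 0) :
    ¬ ((1 : ℕ) : ℕ∞) ≤ natDepth (ringAt p) (moduleAt M p) := by
  intro h
  obtain ⟨r, hr, hreg⟩ := exists_isSMulRegular_of_one_le_natDepth h
  obtain ⟨a, s, rfl⟩ := IsLocalization.exists_mk'_eq p.asIdeal.primeCompl r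
  have ha : a ∈ p.asIdeal := (IsLocalization.AtPrime.mk'_mem_maximal_iff _ p.asIdeal a s).1 hr
  have h0 : LocalizedModule.mk x (1 : p.asIdeal.primeCompl) = 0 := by
    apply hreg.right_eq_zero_of_smul
    rw [← Localization.mk_eq_mk', LocalizedModule.mk_smul_mk, (hx a).1 ha,
      LocalizedModule.zero_mk]
  obtain ⟨u, hu⟩ := (IsLocalizedModule.eq_zero_iff p.asIdeal.primeCompl
    (LocalizedModule.mkLinearMap p.asIdeal.primeCompl M)).1 h0
  exact u.2 ((hx u).2 hu)

/-- The local criterion for torsionfreeness: at every prime, either `M_𝔭` is torsionfree or the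
depths of `M_𝔭` and `R_𝔭` are large. -/
theorem isTorsionfreeOfOrder_of_forall {n : ℕ}
    (H : ∀ p : PrimeSpectrum R, IsTorsionfreeOfOrder n (ringAt p) (moduleAt M p) ∨
      ((n : ℕ∞) ≤ natDepth (ringAt p) (moduleAt M p) ∧
        ((n - 1 : ℕ) : ℕ∞) ≤ natDepth (ringAt p) (ringAt p))) :
    IsTorsionfreeOfOrder n R M := by
  have hnoeth (p : PrimeSpectrum R) : IsNoetherianRing (ringAt p) :=
    IsLocalization.isNoetherianRing p.asIdeal.primeCompl _ ‹_›
  have hfin (p : PrimeSpectrum R) (N : Type u) [AddCommGroup N] [Module R N] [Module.Finite R N] :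
      Module.Finite (ringAt p) (moduleAt N p) :=
    Module.Finite.of_isLocalizedModule p.asIdeal.primeCompl
      (LocalizedModule.mkLinearMap p.asIdeal.primeCompl N)
  induction n generalizing M with
  | zero => exact isTorsionfreeOfOrder_zero _
  | succ n ih =>
    obtain ⟨k, φ, h⟩ := exists_isPushforward R M
    have hφ : Function.Injective φ := by
      by_contra hφ
      have : Nontrivial (LinearMap.ker φ) :=
        Submodule.nontrivial_iff_ne_bot.2 (mt LinearMap.ker_eq_bot.1 hφ)
      -- At an associated prime of `ker φ` the map `φ` stays non-injective and `depth M_𝔭 = 0`, so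
      -- both alternatives of `H` fail.
      obtain ⟨I, hI⟩ := associatedPrimes.nonempty R (LinearMap.ker φ)
      obtain ⟨hIp, x, hx⟩ := isAssociatedPrime_iff.1 (AssociatedPrimes.mem_iff.1 hI)
      let p : PrimeSpectrum R := ⟨I, hIp⟩
      have hxp (r : R) : r ∈ p.asIdeal ↔ r • (x : M) = 0 := by
        change r ∈ I ↔ _
        rw [hx, Submodule.mem_colon_singleton, Submodule.mem_bot, Subtype.ext_iff]
        rfl
      rcases H p with hp | hp
      · have hinj := ((isTorsionfreeOfOrder_succ (h.localization p.asIdeal.primeCompl) n).1 hp).1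
        have h0 : LocalizedModule.mk (x : M) (1 : p.asIdeal.primeCompl) = 0 := by
          apply hinj
          rw [LocalizedModule.map_mk, x.2, LocalizedModule.zero_mk, map_zero]
        obtain ⟨u, hu⟩ := (IsLocalizedModule.eq_zero_iff p.asIdeal.primeCompl
          (LocalizedModule.mkLinearMap p.asIdeal.primeCompl M)).1 h0
        exact u.2 ((hxp u).2 hu)
      · exact not_one_le_natDepth_of_forall_mem_iff hxp
          ((Nat.cast_le.2 (by omega)).trans hp.1)
    refine (isTorsionfreeOfOrder_succ h n).2 ⟨hφ, ih fun p => ?_⟩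
    have hp := h.localization p.asIdeal.primeCompl
    -- Both alternatives pass to `C`. In the second, `depth R_𝔭 ≥ n` bounds the depth of the free
    -- middle term, which is just what the depth lemma needs for `depth C_𝔭 ≥ n`.
    rcases H p with hTF | ⟨hM, hR⟩
    · exact Or.inl ((isTorsionfreeOfOrder_succ hp n).1 hTF).2
    · exact Or.inr ⟨le_natDepth_right hp.exact
        (IsLocalizedModule.map_injective p.asIdeal.primeCompl (LocalizedModule.mkLinearMap _ _)
          (LocalizedModule.mkLinearMap _ _) φ hφ) hp.surjective hM
        (hR.trans (natDepth_self_le_of_flat _)), (Nat.cast_le.2 (by omega)).trans hR⟩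

theorem isTorsionfreeOfOrder_tfae (n : ℕ) :
    List.TFAE [
      IsTorsionfreeOfOrder n R M,
      (∀ p ∈ Module.support R M, natDepth (ringAt p) (ringAt p) < n →
          IsTorsionfreeOfOrder n (ringAt p) (moduleAt M p)) ∧
        ∀ p : PrimeSpectrum R, min (n : ℕ∞) (natDepth (ringAt p) (ringAt p)) ≤
          natDepth (ringAt p) (moduleAt M p),
      (∀ p ∈ Module.support R M, natDepth (ringAt p) (moduleAt M p) < n →
          IsTorsionfreeOfOrder n (ringAt p) (moduleAt M p)) ∧
        (∀ p ∈ Module.support R M, natDepth (ringAt p) (ringAt p) < ((n - 1 : ℕ) : ℕ∞) →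
            natDepth (ringAt p) (moduleAt M p) = natDepth (ringAt p) (ringAt p))] := by
  have hnoeth (p : PrimeSpectrum R) : IsNoetherianRing (ringAt p) :=
    IsLocalization.isNoetherianRing p.asIdeal.primeCompl _ ‹_›
  have hfin (p : PrimeSpectrum R) : Module.Finite (ringAt p) (moduleAt M p) :=
    Module.Finite.of_isLocalizedModule p.asIdeal.primeCompl
      (LocalizedModule.mkLinearMap p.asIdeal.primeCompl M)
  tfae_have 1 → 2 := fun h => by
    -- Testing against natural numbers `k` covers the case of infinite depth.
    refine ⟨fun p _ _ => h.localization _, fun p => ENat.forall_natCast_le_iff_le.1 fun k hk => ?_⟩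
    rw [le_min_iff, Nat.cast_le] at hk
    exact (h.localization p.asIdeal.primeCompl).le_natDepth hk.1 hk.2
  tfae_have 2 → 3 := fun ⟨h1, h2⟩ => by
    refine ⟨fun p hp hlt => h1 p hp ?_, fun p hp hlt => ?_⟩
    · rcases min_le_iff.1 (h2 p) with h | h
      · exact absurd hlt h.not_gt
      · exact h.trans_lt hlt
    · have : Nontrivial (moduleAt M p) := Module.mem_support_iff.1 hp
      exact (h1 p hp (hlt.trans_le (Nat.cast_le.2 n.pred_le))).natDepth_eq hlt
  tfae_have 3 → 1 := fun ⟨h1, h2⟩ => by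
    refine isTorsionfreeOfOrder_of_forall fun p => ?_
    by_cases hp : p ∈ Module.support R M
    · by_cases hM : natDepth (ringAt p) (moduleAt M p) < n
      · exact Or.inl (h1 p hp hM)
      · rw [not_lt] at hM
        refine Or.inr ⟨hM, ?_⟩
        -- If `depth R_𝔭 < n - 1`, the equality of depths in (3) contradicts `depth M_𝔭 ≥ n`.
        by_contra! hR
        rw [h2 p hp hR] at hM
        exact hM.not_gt (hR.trans_le (Nat.cast_le.2 n.pred_le))
    · have : Subsingleton (moduleAt M p) := Module.notMem_support_iff.1 hp
      exact Or.inl (isTorsionfreeOfOrder_of_subsingleton _ _)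
  tfae_finish

end Global

/-! ### Integer-valued bounds on depth -/

section Depth

variable {A : Type u} [CommRing A] [IsLocalRing A] (M : Type v) [AddCommGroup M] [Module A M]

/-- Depth is nonnegative, so a negative bound says no more than the bound `0`. -/
theorem intCast_le_depth_iff (q : ℤ) :
    (q : WithTop ℤ) ≤ depth A M ↔ (q.toNat : ℕ∞) ≤ natDepth A M := by
  unfold depth
  cases h : natDepth A M with
  | top => exact iff_of_true le_top le_top
  | coe n =>
    change (q : WithTop ℤ) ≤ ((n : ℤ) : WithTop ℤ) ↔ _
    rw [WithTop.coe_le_coe, Nat.cast_le]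
    omega

theorem depth_lt_intCast_iff (q : ℤ) :
    depth A M < (q : WithTop ℤ) ↔ natDepth A M < (q.toNat : ℕ∞) := by
  rw [← not_le, intCast_le_depth_iff, not_le]

theorem depth_le_depth_iff (N : Type*) [AddCommGroup N] [Module A N] :
    depth A M ≤ depth A N ↔ natDepth A M ≤ natDepth A N :=
  WithTop.map_le_iff _ (by simp)

theorem depth_eq_depth_iff (N : Type*) [AddCommGroup N] [Module A N] :
    depth A M = depth A N ↔ natDepth A M = natDepth A N := by
  simp only [le_antisymm_iff, depth_le_depth_iff]

end Depth

end AuslanderBridger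

open AuslanderBridger in
theorem theorem6p14 {R : Type u} [CommRing R] [IsNoetherianRing R]
    {M : Type v} [AddCommGroup M] [Module R M] [Module.Finite R M] (q : ℤ) :
    List.TFAE [
      IsTorsionfreeOfOrder q R M,
      (∀ p ∈ Module.support R M, depth (ringAt p) (ringAt p) < (q : WithTop ℤ) →
          IsTorsionfreeOfOrder q (ringAt p) (moduleAt M p)) ∧
        SatisfiesSTilde q R M,
      (∀ p ∈ Module.support R M, depth (ringAt p) (moduleAt M p) < (q : WithTop ℤ) →
          IsTorsionfreeOfOrder q (ringAt p) (moduleAt M p)) ∧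
        (∀ p ∈ Module.support R M,
          depth (ringAt p) (ringAt p) < ((q - 1 : ℤ) : WithTop ℤ) →
            depth (ringAt p) (moduleAt M p) = depth (ringAt p) (ringAt p))] := by
  -- `M` is replaced by an isomorphic quotient of `R^k`, which lives in the universe of `R`, where
  -- the pushforward and `Ext` arguments apply.
  obtain ⟨k, f, hf⟩ := Module.Finite.exists_fin' R M
  let e : ((Fin k → R) ⧸ LinearMap.ker f) ≃ₗ[R] M := f.quotKerEquivOfSurjective hf
  let ep (p : PrimeSpectrum R) :
      moduleAt ((Fin k → R) ⧸ LinearMap.ker f) p ≃ₗ[ringAt p] moduleAt M p :=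
    IsLocalizedModule.mapEquiv p.asIdeal.primeCompl
      (LocalizedModule.mkLinearMap p.asIdeal.primeCompl _)
      (LocalizedModule.mkLinearMap p.asIdeal.primeCompl _) (ringAt p) e
  have key := isTorsionfreeOfOrder_tfae (R := R) (M := (Fin k → R) ⧸ LinearMap.ker f) q.toNat
  simp only [isTorsionfreeOfOrder_congr e, fun p => isTorsionfreeOfOrder_congr (ep p),
    fun p => natDepth_congr (ep p), e.support_eq] at key
  have hpred : (q - 1).toNat = q.toNat - 1 := by omega
  simp only [SatisfiesSTilde, min_le_iff, intCast_le_depth_iff, depth_lt_intCast_iff,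
    depth_le_depth_iff, depth_eq_depth_iff, hpred]
  simp only [min_le_iff] at key
  simp only [isTorsionfreeOfOrder_toNat q]
  exact key
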